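/- **Setting.** Let $M$ be a smooth 4-dimensional Lorentz manifold of signature $(-,+,+,+)$, $m\in M$, and $e_0,e_1,e_2,e_3$ a Lorentz-orthonormal basis of $T_mM$. Identify $T_mM$ with $\mathbb R^4$ by this basis and let $\|\cdot\|$ be the corresponding Euclidean norm. Let $\mathcal O\subset T_mM$ be a neighbourhood of the origin that is identified with a neighbourhood of $m$ in $M$ by the exponential map at $m$ of the Levi-Civita connection $\bar\nabla$ (normal chart). The Lorentz metric and $\bar\nabla$ are regarded as given on $\mathcal O$, points of $\mathcal O$ are regarded as events of $M$, and all tangent spaces $T_xM$, $x\in\mathcal O$, are identified with $T_mM$ by translation. Let $\nabla$ be the flat connection of the linear space $T_mM$, let $G(X,Y)=\nabla_XY-\bar\nabla_XY$, and put $\|G_x\|=\sup_{\|X\|\le1}\|G_x(X,X)\|$. A vector at $x$ lies inside the light cone of $T_xM$ (is time-like) if its Lorentz scalar square at $x$ is negative. **Theorem.** Let $T>0$, and let $a$ be a straight line in $T_mM$ with $a(0)=m_0$, $a(T)=m_1$, $a(\tau)\in\mathcal O$ for $0\le\tau\le T$, whose direction $a'(0)$ lies inside the light cone of $T_{m_0}M$.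 Let $\varepsilon,C>0$ be numbers such that every continuous curve $v:[0,1]\to T_mM$ with $\sup\|v\|<\varepsilon$ has a vector $C_v\in T_mM$ with the following properties: $C_v$ depends continuously on $v$ and stays in a bounded neighbourhood of $m_1-m_0$; $C_v$ lies inside the light cone of $T_{m_0}M$; $\|C_v\|<C$; and the curve $$a_v(s)=m_0+\int_0^s\bigl(v(t)+C_v\bigr)\,dt,\qquad 0\le s\le 1,$$ satisfies $a_v(1)=m_1$. Let $V\subset\mathcal O$ be a (Euclidean, open or closed) ball that contains $m_0$, $m_1$ and all the curves $a_v$, and suppose that $$\|G_x\|<\frac{\varepsilon}{(\varepsilon+C)^2}\qquad\text{for all }x\in V .$$ Then there is a time-like geodesic $\gamma:[0,T]\to M$ of the Levi-Civita connection with $\gamma(0)=m_0$ and $\gamma(T)=m_1$. Moreover, for every time orientation of $M$ for which $a'(0)$ is future-directed at $m_0$, the geodesic $\gamma$ is future-directed; in particular $m_1$ lies in the proper (chronological) future of $m_0$, i.e. it is reached from $m_0$ by a future-directed time-like curve. -/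

import Mathlib

open Set Topology
open scoped Manifold ContDiff

/-- The model space `ℝ⁴` with its Euclidean norm; coordinates are numbered `0, 1, 2, 3`. -/
abbrev E4 : Type := EuclideanSpace ℝ (Fin 4)

noncomputable section

/-! ### Levi-Civita connection of a metric tensor on a domain of `ℝ⁴` -/

/-- The linear form
`w ↦ ½ (∂_u h (v, w) + ∂_v h (u, w) - ∂_w h (u, v))` at the point `x`
(Christoffel symbols of the first kind). -/
def christoffelForm (h : E4 → E4 →L[ℝ] E4 →L[ℝ] ℝ) (x u v : E4) : E4 →L[ℝ] ℝ :=
  (1 / 2 : ℝ) • (fderiv ℝ h x u v + fderiv ℝ h x v u - ((fderiv ℝ h x).flip u).flip v)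

/-- Christoffel symbols (of the second kind) of `h`: for nondegenerate `h x`, the vector
`Γ_x(u, v)` with `h_x (Γ_x(u, v), w) = christoffelForm h x u v w` for all `w`. -/
def christoffel (h : E4 → E4 →L[ℝ] E4 →L[ℝ] ℝ) (x u v : E4) : E4 :=
  (h x).inverse (christoffelForm h x u v)

/-- Covariant derivative `∇_X Y` of the flat connection of the linear space `ℝ⁴`. -/
def flatNabla (X Y : E4 → E4) (x : E4) : E4 := fderiv ℝ Y x (X x)

/-- Covariant derivative of the Levi-Civita connection of `h`. -/
def leviCivitaNabla (h : E4 → E4 →L[ℝ] E4 →L[ℝ] ℝ) (X Y : E4 → E4) (x : E4) : E4 :=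
  fderiv ℝ Y x (X x) + christoffel h x (X x) (Y x)

/-- The value `G_x(u, v)` of the tensor `G(X, Y) = ∇_X Y - ∇̄_X Y` (flat minus Levi-Civita) on two
vectors, computed on the constant extensions of these vectors; see `gravity_apply` for arbitrary
fields. -/
def gravity (h : E4 → E4 →L[ℝ] E4 →L[ℝ] ℝ) (x u v : E4) : E4 :=
  flatNabla (fun _ => u) (fun _ => v) x - leviCivitaNabla h (fun _ => u) (fun _ => v) x

/-- `‖G_x‖ = sup_{‖X‖ ≤ 1} ‖G_x(X, X)‖`, with Euclidean norms. -/
def gravityNorm (h : E4 → E4 →L[ℝ] E4 →L[ℝ] ℝ) (x : E4) : ℝ :=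
  sSup ((fun X : E4 => ‖gravity h x X X‖) '' Metric.closedBall 0 1)

theorem christoffel_spec (h : E4 → E4 →L[ℝ] E4 →L[ℝ] ℝ) (x u v w : E4)
    (hx : (h x).IsInvertible) :
    h x (christoffel h x u v) w =
      (1 / 2) * (fderiv ℝ h x u v w + fderiv ℝ h x v u w - fderiv ℝ h x w u v) := by
  obtain ⟨L, hL⟩ := hx
  have : h x (christoffel h x u v) = christoffelForm h x u v := by
    rw [christoffel, ← hL]
    simp
  rw [this]
  simp [christoffelForm]

theorem gravity_apply (h : E4 → E4 →L[ℝ] E4 →L[ℝ] ℝ) (X Y : E4 → E4) (x : E4) :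
    flatNabla X Y x - leviCivitaNabla h X Y x = gravity h x (X x) (Y x) := by
  simp [gravity, flatNabla, leviCivitaNabla]

theorem gravity_eq (h : E4 → E4 →L[ℝ] E4 →L[ℝ] ℝ) (x u v : E4) :
    gravity h x u v = -christoffel h x u v := by
  simp [gravity, flatNabla, leviCivitaNabla]

theorem continuous_christoffel_aux {E F : Type*} [NormedAddCommGroup E] [NormedSpace ℝ E]
    [NormedAddCommGroup F] [NormedSpace ℝ F]
    (D : E →L[ℝ] E →L[ℝ] E →L[ℝ] ℝ) (L : (E →L[ℝ] ℝ) →L[ℝ] F) :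
    Continuous fun X : E => ‖L ((1 / 2 : ℝ) • (D X X + D X X - (D.flip X).flip X))‖ := by
  have h₁ : Continuous fun X : E => D X X := D.continuous.clm_apply continuous_id
  have h₂ : Continuous fun X : E => (D.flip X).flip :=
    (ContinuousLinearMap.flipₗᵢ ℝ E E ℝ).continuous.comp D.flip.continuous
  have h₃ : Continuous fun X : E => (D.flip X).flip X := h₂.clm_apply continuous_id
  exact (L.continuous.comp (((h₁.add h₁).sub h₃).const_smul (1 / 2 : ℝ))).norm

/-- The set whose supremum is `gravityNorm` is bounded, so that the supremum is genuine. -/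
theorem bddAbove_gravity (h : E4 → E4 →L[ℝ] E4 →L[ℝ] ℝ) (x : E4) :
    BddAbove ((fun X : E4 => ‖gravity h x X X‖) '' Metric.closedBall 0 1) := by
  refine (isCompact_closedBall (0 : E4) 1).bddAbove_image (Continuous.continuousOn ?_)
  simp only [gravity_eq, norm_neg, christoffel, christoffelForm]
  exact continuous_christoffel_aux (fderiv ℝ h x) (h x).inverse

/-! ### Lorentz manifolds -/

section Manifold

variable {M : Type*} [TopologicalSpace M] [ChartedSpace E4 M]

/-- Matrix of the Minkowski scalar product, `diag(-1, 1, 1, 1)`. -/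
def minkowskiMatrix (i j : Fin 4) : ℝ := if i = j then (if i = 0 then -1 else 1) else 0

/-- The coordinate expression, in the chart `e`, of a field `B` of bilinear forms on the tangent
spaces of `M`; it is a field of bilinear forms on `e.target ⊆ ℝ⁴`. -/
def formInChart (B : ∀ p : M, TangentSpace 𝓘(ℝ, E4) p →L[ℝ] TangentSpace 𝓘(ℝ, E4) p →L[ℝ] ℝ)
    (e : OpenPartialHomeomorph M E4) (x : E4) : E4 →L[ℝ] E4 →L[ℝ] ℝ :=
  ContinuousLinearMap.bilinearComp (E := E4) (F := E4) (E' := E4) (F' := E4)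
    (B (e.symm x))
    (mfderiv 𝓘(ℝ, E4) 𝓘(ℝ, E4) e.symm x) (mfderiv 𝓘(ℝ, E4) 𝓘(ℝ, E4) e.symm x)

variable (M) in
/-- A smooth Lorentz metric of signature `(-, +, +, +)` on the `4`-manifold `M`. -/
structure LorentzMetric where
  /-- the scalar product on each tangent space -/
  form : ∀ p : M, TangentSpace 𝓘(ℝ, E4) p →L[ℝ] TangentSpace 𝓘(ℝ, E4) p →L[ℝ] ℝ
  symm : ∀ (p : M) (u v : TangentSpace 𝓘(ℝ, E4) p), form p u v = form p v u
  signature : ∀ p : M, ∃ e : Fin 4 → TangentSpace 𝓘(ℝ, E4) p,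
    ∀ i j, form p (e i) (e j) = minkowskiMatrix i j
  smooth : ∀ e ∈ IsManifold.maximalAtlas 𝓘(ℝ, E4) ∞ M,
    ContDiffOn ℝ ∞ (formInChart form e) e.target

/-- Velocity of the curve `γ` at time `t`; derivatives are taken within the time interval `s`
(one-sided at its end points). -/
def velocity (γ : ℝ → M) (s : Set ℝ) (t : ℝ) : TangentSpace 𝓘(ℝ, E4) (γ t) :=
  mfderivWithin 𝓘(ℝ, ℝ) 𝓘(ℝ, E4) γ s t (1 : ℝ)

namespace LorentzMetric

variable (g : LorentzMetric M)

/-- A tangent vector lies inside the light cone. -/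
def IsTimelike {p : M} (X : TangentSpace 𝓘(ℝ, E4) p) : Prop := g.form p X X < 0

/-- Coordinate expression of the metric in a chart. -/
def inChart (e : OpenPartialHomeomorph M E4) : E4 → E4 →L[ℝ] E4 →L[ℝ] ℝ := formInChart g.form e

/-- `γ` is a geodesic of the Levi-Civita connection on the time interval `s`: around every time, in
some smooth chart `e`, the coordinate curve `x = e ∘ γ` has a velocity `u = x'` with
`u' + Γ_x(u, u) = 0` (this condition does not depend on the smooth chart used). -/
def IsGeodesicOn (γ : ℝ → M) (s : Set ℝ) : Prop :=
  ContinuousOn γ s ∧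
    ∀ t ∈ s, ∃ e ∈ IsManifold.maximalAtlas 𝓘(ℝ, E4) ∞ M, γ t ∈ e.source ∧
      ∃ u : ℝ → E4, ∀ᶠ t' in 𝓝[s] t,
        HasDerivWithinAt (fun r => e (γ r)) (u t') s t' ∧
        HasDerivWithinAt u (-christoffel (g.inChart e) (e (γ t')) (u t') (u t')) s t'

/-- `exp_m(v) = q` for the exponential map of the Levi-Civita connection: the geodesic starting at
`m` with velocity `v` is defined on `[0, 1]` and is at `q` at time `1`. -/
def ExpEq (m : M) (v : TangentSpace 𝓘(ℝ, E4) m) (q : M) : Prop :=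
  ∃ γ : ℝ → M, g.IsGeodesicOn γ (Icc 0 1) ∧
    (⟨γ 0, velocity γ (Icc 0 1) 0⟩ : TangentBundle 𝓘(ℝ, E4) M) = ⟨m, v⟩ ∧ γ 1 = q

/-- The reference frame at the event `m`: a Lorentz-orthonormal basis `e₀, e₁, e₂, e₃` of `T_m M`,
by which `T_m M` is identified with `ℝ⁴`, and a normal chart, i.e. a smooth chart `U → O` from a
neighbourhood of `m` to a neighbourhood of the origin of `T_m M` whose inverse is `exp_m`. -/
structure ReferenceFrame (m : M) where
  basis : Fin 4 → TangentSpace 𝓘(ℝ, E4) m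
  orthonormal : ∀ i j, g.form m (basis i) (basis j) = minkowskiMatrix i j
  chart : OpenPartialHomeomorph M E4
  chart_mem : chart ∈ IsManifold.maximalAtlas 𝓘(ℝ, E4) ∞ M
  base_mem : m ∈ chart.source
  zero_mem : (0 : E4) ∈ chart.target
  exp_eq : ∀ x ∈ chart.target, g.ExpEq m (∑ i, x i • basis i) (chart.symm x)

namespace ReferenceFrame

variable {g} {m : M} (R : g.ReferenceFrame m)

/-- The domain `O` of the linear space `T_m M ≅ ℝ⁴`. -/
def domain : Set E4 := R.chart.target

/-- The event of `M` with coordinates `x`. -/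
def event (x : E4) : M := R.chart.symm x

/-- The tangent vector of `M` at `R.event x` with coordinates `u`. -/
def tangent (x u : E4) : TangentSpace 𝓘(ℝ, E4) (R.event x) :=
  mfderiv 𝓘(ℝ, E4) 𝓘(ℝ, E4) R.chart.symm x u

/-- The Lorentz metric carried over to `O`. -/
def metric : E4 → E4 →L[ℝ] E4 →L[ℝ] ℝ := g.inChart R.chart

end ReferenceFrame

variable [IsManifold 𝓘(ℝ, E4) ∞ M]

/-- A time orientation: a continuous timelike vector field, declared to point to the future. -/
structure TimeOrientation where
  field : ∀ p : M, TangentSpace 𝓘(ℝ, E4) p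
  continuous : Continuous (fun p => (⟨p, field p⟩ : TangentBundle 𝓘(ℝ, E4) M))
  timelike : ∀ p, g.IsTimelike (field p)

variable {g} in
/-- `X` is timelike and future-directed. -/
def TimeOrientation.IsFuture (τ : g.TimeOrientation) {p : M} (X : TangentSpace 𝓘(ℝ, E4) p) : Prop :=
  g.IsTimelike X ∧ g.form p X (τ.field p) < 0

variable {g} in
/-- The proper (chronological) future of `p`: the events that can be reached from `p` along a
future-directed timelike curve. -/
def TimeOrientation.properFuture (τ : g.TimeOrientation) (p : M) : Set M :=
  {q | ∃ γ : ℝ → M, ContMDiffOn 𝓘(ℝ, ℝ) 𝓘(ℝ, E4) 1 γ (Icc 0 1) ∧ γ 0 = p ∧ γ 1 = q ∧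
    ∀ t ∈ Icc (0 : ℝ) 1, τ.IsFuture (velocity γ (Icc 0 1) t)}

end LorentzMetric

end Manifold

/-- The curve `s ↦ p + ∫₀ˢ (v(t) + c) dt` on `[0, 1]`. -/
def integralCurve (p : E4) (v : C(unitInterval, E4)) (c : E4) (s : ℝ) : E4 :=
  p + ∫ t in (0 : ℝ)..s, (IccExtend zero_le_one v t + c)

/-- The numbers `ε, C > 0` and the map `v ↦ c v` are as follows: on the ball `‖v‖ < ε` of
`C⁰([0,1], ℝ⁴)` the map `c` is continuous with values in a bounded neighbourhood of the
initial direction `m₁ - m₀` of the segment `s ↦ m₀ + s (m₁ - m₀)`, the vector `c v` lies inside the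
light cone of `h` at `m₀`, the curve `m₀ + ∫₀ˢ (v(t) + c v) dt` is at `m₁` for `s = 1`, and
`‖c v‖ < C`. -/
structure IsCorrection (h : E4 → E4 →L[ℝ] E4 →L[ℝ] ℝ) (m₀ m₁ : E4) (ε C : ℝ)
    (c : C(unitInterval, E4) → E4) : Prop where
  eps_pos : 0 < ε
  C_pos : 0 < C
  continuousOn : ContinuousOn c (Metric.ball 0 ε)
  near : ∃ N ∈ 𝓝 (m₁ - m₀), Bornology.IsBounded N ∧ ∀ v ∈ Metric.ball 0 ε, c v ∈ N
  timelike : ∀ v ∈ Metric.ball 0 ε, h m₀ (c v) (c v) < 0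
  endpoint : ∀ v ∈ Metric.ball 0 ε, integralCurve m₀ v (c v) 1 = m₁
  bound : ∀ v ∈ Metric.ball 0 ε, ‖c v‖ < C

end

/-! ### Fixed point theorems of Brouwer and Schauder. -/

section Brouwer

open MeasureTheory Metric Filter Polynomial

/-! In the normal chart a geodesic satisfies `x'' = Q(x, x')` with `Q(x, u) = -Γ_x(u, u) = G_x(u,
u)`. Writing `x' = v + c v`, the correction `c v` takes care of both end points, and what remains is
the fixed point equation `v(s) = ∫₀ˢ Q(x, v + c v)` in `C([0,1], ℝ⁴)`. The crude bound `‖v + c v‖ ≤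
ε + C` only gives `‖∫Q‖ ≤ ε`, whereas `c` is controlled on the open `ε`-ball. Since `v + c v` has
mean `m₁ - m₀`, its mean square is at most `ε² + C²`, so the operator has values in a closed ball of
radius `r = ε(ε² + C²)/(ε + C)² < ε`; Schauder's theorem applies
(`exists_integralCurve_boundaryValue`).

The solution has `v(0) = 0`, hence initial velocity `c v`, which is timelike; the scalar square of
the velocity is conserved (`metric_velocity_eq_of_geodesic`), so the geodesic stays timelike.
Timelike vectors are never orthogonal, so the sign of the product with a time orientation cannot
change: neither along `t ↦ c (t • v)`, which joins `m₁ - m₀` to `c v`, nor along the geodesic.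

Schauder's theorem is reduced to Brouwer's, and Brouwer's to the absence of a `C¹` retraction of the
ball onto its sphere, by the Milnor–Rogers volume argument. -/

theorem exists_polynomial_det_id_add_smul {X : Type*} [NormedAddCommGroup X] [NormedSpace ℝ X]
    [FiniteDimensional ℝ X] (A : X →L[ℝ] X) :
    ∃ p : ℝ[X], p.natDegree ≤ Module.finrank ℝ X ∧
      ∀ t : ℝ, p.eval t = (ContinuousLinearMap.id ℝ X + t • A).det := by
  let b := Module.finBasis ℝ X
  let N := LinearMap.toMatrix b b (A : X →ₗ[ℝ] X)
  refine ⟨Matrix.det ((Polynomial.X : ℝ[X]) • N.map C + (1 : Matrix _ _ ℝ).map C), ?_, fun t => ?_⟩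
  · simpa using Polynomial.natDegree_det_X_add_C_le N 1
  · rw [← coe_evalRingHom, RingHom.map_det, ContinuousLinearMap.det, ← LinearMap.det_toMatrix b]
    congr 1
    ext i j
    simp [N, LinearMap.toMatrix_apply, Matrix.one_apply, Finsupp.single_apply, eq_comm]
    split_ifs <;> simp <;> ring

/-- A polynomial of bounded degree is determined at `1` by its values on `(0, δ)`, so the mean
of a family of such polynomials is constant if it is constant on `(0, δ)`. -/
theorem integral_eq_of_polynomial {α : Type*} [MeasurableSpace α] {μ : Measure α}
    {q : α → ℝ → ℝ} {n : ℕ} (hq : ∀ x, ∃ p : ℝ[X], p.natDegree ≤ n ∧ ∀ t, p.eval t = q x t)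
    (hint : ∀ t, Integrable (fun x => q x t) μ) {δ K : ℝ} (hδ : 0 < δ)
    (hK : ∀ t ∈ Ioo 0 δ, ∫ x, q x t ∂μ = K) : ∫ x, q x 1 ∂μ = K := by
  let s := Finset.range (n + 1)
  -- These are `n + 1` distinct interpolation nodes inside `(0, δ)`, the same for every `x` because
  -- the degree bound is uniform.
  let v : ℕ → ℝ := fun i => δ / (i + 2)
  have hv : Set.InjOn v s := by
    intro i _ j _ hij
    have hi : (0 : ℝ) < i + 2 := by positivity
    have hj : (0 : ℝ) < j + 2 := by positivity
    simp only [v] at hij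
    field_simp at hij
    exact_mod_cast (add_right_cancel hij).symm
  have hvδ : ∀ i, v i ∈ Ioo 0 δ := fun i => by
    refine ⟨by positivity, ?_⟩
    simp only [v]
    rw [div_lt_iff₀ (by positivity)]
    nlinarith [(Nat.cast_nonneg i : (0 : ℝ) ≤ i)]
  have key : ∀ (p : ℝ[X]), p.natDegree ≤ n →
      p.eval 1 = ∑ i ∈ s, p.eval (v i) * (Lagrange.basis s v i).eval 1 := fun p hp => by
    have hdeg : p.degree < s.card := by
      refine lt_of_le_of_lt (degree_le_of_natDegree_le hp) ?_
      rw [Finset.card_range]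
      exact_mod_cast Nat.lt_succ_self n
    conv_lhs => rw [Lagrange.eq_interpolate hv hdeg, Lagrange.interpolate_apply]
    simp [eval_finsetSum]
  have h₁ : ∀ x, q x 1 = ∑ i ∈ s, q x (v i) * (Lagrange.basis s v i).eval 1 := fun x => by
    obtain ⟨p, hp, hpq⟩ := hq x
    simpa only [hpq] using key p hp
  -- Interpolation of the constant polynomial 1.
  have h₂ : ∑ i ∈ s, (Lagrange.basis s v i).eval 1 = 1 := by
    simpa using (key 1 (by simp)).symm
  calc ∫ x, q x 1 ∂μ = ∑ i ∈ s, (∫ x, q x (v i) ∂μ) * (Lagrange.basis s v i).eval 1 := by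
        simp_rw [h₁]
        rw [integral_finsetSum _ fun i _ => (hint (v i)).mul_const _]
        simp_rw [integral_mul_const]
    _ = K := by
        rw [Finset.sum_congr rfl fun i _ => by rw [hK _ (hvδ i)], ← Finset.mul_sum, h₂, mul_one]


section

variable {X : Type*} [NormedAddCommGroup X] [InnerProductSpace ℝ X] [FiniteDimensional ℝ X]

/-- The map is a perturbation of the identity with Lipschitz constant `t * K < 1`, hence injective
and open. The image of the open ball is also relatively closed in the ball: a limit point comes from
the closed ball, and the sphere is fixed. Connectedness then gives surjectivity. -/
theorem image_ball_eq_of_lipschitzOnWith {f : X → X} {K : NNReal}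
    (hL : LipschitzOnWith K (fun x => f x - x) (closedBall 0 1))
    (hsph : ∀ x, ‖x‖ = 1 → f x = x) (hball : ∀ x ∈ closedBall (0 : X) 1, ‖f x‖ ≤ 1)
    {t : ℝ} (ht : 0 ≤ t) (ht1 : t < 1) (htK : t * K < 1) :
    InjOn (fun x => x + t • (f x - x)) (ball 0 1) ∧
      (fun x => x + t • (f x - x)) '' ball 0 1 = ball 0 1 := by
  set F : X → X := fun x => x + t • (f x - x) with hF
  let t' : NNReal := ⟨t, ht⟩
  have hK1 : t' * K < 1 := by
    rw [← NNReal.coe_lt_coe, NNReal.coe_mul]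
    exact htK
  have happ : ApproximatesLinearOn F
      ((ContinuousLinearEquiv.refl ℝ X : X ≃L[ℝ] X) : X →L[ℝ] X) (closedBall 0 1) (t' * K) := by
    rw [ApproximatesLinearOn.approximatesLinearOn_iff_lipschitzOnWith]
    refine LipschitzOnWith.of_dist_le_mul fun x hx y hy => ?_
    have := hL.dist_le_mul x hx y hy
    have h₂ : ∀ z, (F - ((ContinuousLinearEquiv.refl ℝ X : X ≃L[ℝ] X) : X →L[ℝ] X)) z
        = t • (f z - z) := fun z => by simp [F]
    rw [h₂, h₂, dist_smul₀, Real.norm_of_nonneg ht, NNReal.coe_mul, mul_assoc]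
    exact mul_le_mul_of_nonneg_left this ht
  have hc : Subsingleton X ∨
      t' * K < ‖((ContinuousLinearEquiv.refl ℝ X).symm : X →L[ℝ] X)‖₊⁻¹ := by
    rcases subsingleton_or_nontrivial X with h | h
    · exact Or.inl h
    · right
      have : ((ContinuousLinearEquiv.refl ℝ X).symm : X →L[ℝ] X) = ContinuousLinearMap.id ℝ X := rfl
      rw [this]
      simpa using hK1
  have hinj : InjOn F (closedBall 0 1) := happ.injOn hc
  have hnorm : ∀ x, ‖x‖ < 1 → ‖F x‖ < 1 := fun x hx => by
    have h₁ : F x = (1 - t) • x + t • f x := by simp only [F]; module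
    have h₂ : ‖f x‖ ≤ 1 := hball x (by simpa using hx.le)
    calc ‖F x‖ ≤ (1 - t) * ‖x‖ + t * ‖f x‖ := by
          rw [h₁]
          refine (norm_add_le _ _).trans (le_of_eq ?_)
          rw [norm_smul, norm_smul, Real.norm_of_nonneg ht, Real.norm_of_nonneg (by linarith)]
      _ < 1 := by nlinarith
  refine ⟨hinj.mono ball_subset_closedBall, Subset.antisymm ?_ ?_⟩
  · rintro _ ⟨x, hx, rfl⟩
    simpa using hnorm x (by simpa using hx)
  · have hopen : IsOpen (F '' ball 0 1) :=
      (happ.mono_set ball_subset_closedBall).open_image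
        (ContinuousLinearEquiv.refl ℝ X).toNonlinearRightInverse isOpen_ball hc
    have hcl : IsClosed (F '' closedBall 0 1) :=
      ((isCompact_closedBall (0 : X) 1).image_of_continuousOn happ.continuousOn).isClosed
    refine (convex_ball (0 : X) 1).isPreconnected.subset_of_closure_inter_subset hopen
      ⟨F 0, by simpa using hnorm 0 (by simp), mem_image_of_mem _ (by simp)⟩ ?_
    rintro y ⟨hy, hy1⟩
    obtain ⟨x, hx, rfl⟩ := hcl.closure_subset_iff.2 (image_mono ball_subset_closedBall) hy
    refine mem_image_of_mem _ ?_
    rw [mem_closedBall_zero_iff] at hx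
    rw [mem_ball_zero_iff] at hy1 ⊢
    refine lt_of_le_of_ne hx fun h => ?_
    simp [F, hsph x h, h] at hy1

/-- For small `t` the map `id + t (f - id)` carries the ball bijectively onto itself, so its
Jacobian integrates to the volume of the ball. The integral is polynomial in `t`, so this persists
at `t = 1`, where the Jacobian of `f` vanishes. -/
theorem not_contDiffOn_retraction_closedBall {f : X → X} {U : Set X} (hU : IsOpen U)
    (hBU : closedBall 0 1 ⊆ U) (hf : ContDiffOn ℝ 1 f U) (hsph : ∀ x, ‖x‖ = 1 → f x = x)
    (hball : ∀ x ∈ closedBall (0 : X) 1, ‖f x‖ = 1) : False := by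
  borelize X
  let μ : Measure X := Measure.addHaar
  let D : X → X →L[ℝ] X := fun x => fderiv ℝ f x - ContinuousLinearMap.id ℝ X
  have hD : ContinuousOn D U :=
    (hf.continuousOn_fderiv_of_isOpen hU le_rfl).sub continuousOn_const
  have hdiff : ∀ x ∈ U, HasFDerivAt f (fderiv ℝ f x) x := fun x hx =>
    ((hf.contDiffAt (hU.mem_nhds hx)).differentiableAt one_ne_zero).hasFDerivAt
  obtain ⟨K, hK⟩ := ((hf.sub contDiffOn_id).mono hBU).exists_lipschitzOnWith one_ne_zero
    (convex_closedBall (0 : X) 1) (isCompact_closedBall _ _)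
  let q : X → ℝ → ℝ := fun x t => (ContinuousLinearMap.id ℝ X + t • D x).det
  have hqc : ∀ t, ContinuousOn (fun x => q x t) U := fun t =>
    ContinuousLinearMap.continuous_det.comp_continuousOn
      (continuousOn_const.add (hD.const_smul t))
  have hpos : ∀ᶠ t in 𝓝 (0 : ℝ), ∀ x ∈ closedBall (0 : X) 1, 0 < q x t := by
    refine (isCompact_closedBall (0 : X) 1).eventually_forall_of_forall_eventually fun y hy => ?_
    have hDy : ContinuousAt D y := hD.continuousAt (hU.mem_nhds (hBU hy))
    have : ContinuousAt (fun z : ℝ × X => q z.2 z.1) (0, y) := by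
      refine ContinuousLinearMap.continuous_det.continuousAt.comp ?_
      exact continuousAt_const.add (continuousAt_fst.smul (ContinuousAt.comp (f := Prod.snd) (x := ((0 : ℝ), y)) hDy continuousAt_snd))
    refine this.eventually_const_lt ?_
    simp [q, ContinuousLinearMap.det]
  obtain ⟨δ₀, hδ₀, hδ₀'⟩ := Metric.eventually_nhds_iff.1 hpos
  -- Below `δ₀` the Jacobian is positive; below `1 / (K + 1)` both `t < 1` and `t * K < 1`.
  let δ : ℝ := min δ₀ (1 / (K + 1))
  have hδ : 0 < δ := lt_min hδ₀ (by positivity)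
  have hint : ∀ t, Integrable (fun x => q x t) (μ.restrict (ball 0 1)) := fun t =>
    (((hqc t).mono hBU).integrableOn_compact (isCompact_closedBall _ _)).mono_set
      ball_subset_closedBall
  have hvol : ∀ t ∈ Ioo 0 δ, ∫ x in ball 0 1, q x t ∂μ = μ.real (ball 0 1) := by
    intro t ht
    have htK : t * (K + 1) < 1 := by
      have := ht.2.trans_le (min_le_right _ _)
      rwa [lt_div_iff₀ (by positivity)] at this
    have hK0 : (0 : ℝ) ≤ K := K.2
    obtain ⟨hinj, himg⟩ := image_ball_eq_of_lipschitzOnWith hK hsph (fun x hx => (hball x hx).le)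
      ht.1.le (by nlinarith [ht.1]) (by nlinarith [ht.1])
    have hder : ∀ x ∈ ball (0 : X) 1, HasFDerivWithinAt (fun x => x + t • (f x - x))
        (ContinuousLinearMap.id ℝ X + t • D x) (ball 0 1) x := fun x hx =>
      ((hasFDerivAt_id x).add (((hdiff x (hBU (ball_subset_closedBall hx))).sub
        (hasFDerivAt_id x)).const_smul t)).hasFDerivWithinAt
    have h := integral_image_eq_integral_abs_det_fderiv_smul μ measurableSet_ball hder hinj
      (fun _ => (1 : ℝ))
    rw [himg] at h
    simp only [integral_const, smul_eq_mul, mul_one] at h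
    rw [measureReal_restrict_apply_univ] at h
    rw [h]
    refine setIntegral_congr_fun measurableSet_ball fun x hx => ?_
    refine (abs_of_pos (hδ₀' ?_ x (ball_subset_closedBall hx))).symm
    rw [Real.dist_eq, sub_zero, abs_of_pos ht.1]
    exact ht.2.trans_le (min_le_left _ _)
  have h1 := integral_eq_of_polynomial (fun x => exists_polynomial_det_id_add_smul (D x))
    hint hδ hvol
  -- Differentiating `⟪f, f⟫ = 1` shows that the range of the derivative is orthogonal to `f x ≠ 0`,
  -- so the derivative is not surjective.
  have h0 : ∫ x in ball 0 1, q x 1 ∂μ = 0 := by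
    refine setIntegral_eq_zero_of_forall_eq_zero fun x hx => ?_
    have hq : q x 1 = (fderiv ℝ f x).det := by simp [q, D]
    rw [hq]
    by_contra hne
    have hxU := hBU (ball_subset_closedBall hx)
    have hin : HasFDerivAt (fun y => inner ℝ (f y) (f y)) _ x := (hdiff x hxU).inner ℝ (hdiff x hxU)
    have hconst : (fun y => inner ℝ (f y) (f y)) =ᶠ[𝓝 x] fun _ => (1 : ℝ) := by
      filter_upwards [isOpen_ball.mem_nhds hx] with y hy
      rw [real_inner_self_eq_norm_sq, hball y (ball_subset_closedBall hy), one_pow]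
    have hz := hin.unique ((hasFDerivAt_const (1 : ℝ) x).congr_of_eventuallyEq hconst)
    let e := LinearMap.equivOfDetNeZero (fderiv ℝ f x : X →ₗ[ℝ] X) hne
    obtain ⟨u, hu⟩ := e.surjective (f x)
    have hu' : fderiv ℝ f x u = f x := hu
    have := DFunLike.congr_fun hz u
    simp [hu', hball x (ball_subset_closedBall hx)] at this
  rw [h0] at h1
  exact (ENNReal.toReal_pos (measure_ball_pos μ (0 : X) one_pos).ne' measure_ball_lt_top.ne).ne h1

/-- A `C¹` map of Euclidean space which is the identity on the unit sphere has a zero in the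
unit ball. -/
theorem exists_zero_of_contDiff_of_eq_on_sphere {f : X → X} (hf : ContDiff ℝ 1 f)
    (hsph : ∀ x, ‖x‖ = 1 → f x = x) : ∃ x ∈ closedBall (0 : X) 1, f x = 0 := by
  by_contra! h
  refine not_contDiffOn_retraction_closedBall (f := fun x => ‖f x‖⁻¹ • f x) (U := {x | f x ≠ 0})
    (isOpen_ne_fun hf.continuous continuous_const) h ?_ ?_ ?_
  · intro x hx
    have h1 := hf.contDiffAt (x := x)
    exact (((h1.norm ℝ hx).inv (norm_ne_zero_iff.2 hx)).smul h1).contDiffWithinAt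
  · intro x hx
    simp [hsph x hx, hx]
  · intro x hx
    rw [norm_smul, norm_inv, norm_norm, inv_mul_cancel₀ (norm_ne_zero_iff.2 (h x hx))]

/-- Rescaling by `2 * R` brings the values of `F` into the ball of radius 1/2, where the cutoff `χ`
equals 1. As `χ` vanishes on the unit sphere, `x - χ x • (rescaled F) x` is the identity there and
has a zero; that zero has norm at most 1/2, so the cutoff is invisible. -/
theorem exists_fixedPoint_of_contDiff_of_bounded {F : X → X} (hF : ContDiff ℝ 1 F) {R : ℝ}
    (hR : 0 < R) (hb : ∀ x, ‖F x‖ ≤ R) : ∃ x, F x = x := by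
  let χ : ContDiffBump (0 : X) := ⟨1 / 2, 1, by norm_num, by norm_num⟩
  have hF' : ContDiff ℝ 1 fun x : X => F ((2 * R) • x) := hF.comp (contDiff_id.const_smul _)
  obtain ⟨x, -, hx⟩ := exists_zero_of_contDiff_of_eq_on_sphere
    (f := fun x => x - χ x • ((2 * R)⁻¹ • F ((2 * R) • x)))
    (contDiff_id.sub (χ.contDiff.smul (hF'.const_smul _)))
    (fun x hx => by
      rw [χ.zero_of_le_dist (by simp [χ, hx]), zero_smul, sub_zero])
  have hx' := sub_eq_zero.1 hx
  have hxn : ‖x‖ ≤ 1 / 2 := by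
    rw [hx', norm_smul, norm_smul, Real.norm_of_nonneg χ.nonneg, norm_inv,
      Real.norm_of_nonneg (by positivity)]
    calc χ x * ((2 * R)⁻¹ * ‖F ((2 * R) • x)‖) ≤ 1 * ((2 * R)⁻¹ * R) := by
          gcongr
          · exact χ.le_one
          · exact hb _
      _ = 1 / 2 := by field_simp
  rw [χ.one_of_mem_closedBall (by simpa [χ] using hxn), one_smul] at hx'
  refine ⟨(2 * R) • x, ?_⟩
  conv_rhs => rw [hx']
  rw [smul_smul, mul_inv_cancel₀ (by positivity), one_smul]

/-- Brouwer's theorem, for bounded continuous maps of a Euclidean space into itself. -/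
theorem exists_fixedPoint_of_continuous_of_bounded {F : X → X} (hF : Continuous F) {R : ℝ}
    (hb : ∀ x, ‖F x‖ ≤ R) : ∃ x, F x = x := by
  have hR : 0 ≤ R := (norm_nonneg _).trans (hb 0)
  have happ : ∀ n : ℕ, ∃ x, ‖x‖ ≤ R + 1 ∧ dist x (F x) < 1 / ((n : ℝ) + 1) := fun n => by
    have hn : (0 : ℝ) < 1 / ((n : ℝ) + 1) := by positivity
    obtain ⟨G, hG, hGF, -⟩ := hF.exists_contDiff_approx 1
      (continuous_const : Continuous fun _ : X => 1 / ((n : ℝ) + 1)) fun _ => hn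
    have hGb : ∀ x, ‖G x‖ ≤ R + 1 := fun x => by
      have h₁ : ‖G x - F x‖ ≤ 1 := by
        rw [← dist_eq_norm]
        refine (hGF x).le.trans ?_
        rw [div_le_one (by positivity)]
        linarith [(Nat.cast_nonneg n : (0 : ℝ) ≤ n)]
      calc ‖G x‖ = ‖F x + (G x - F x)‖ := by congr 1; abel
        _ ≤ R + 1 := (norm_add_le _ _).trans (add_le_add (hb x) h₁)
    obtain ⟨x, hx⟩ := exists_fixedPoint_of_contDiff_of_bounded hG (by linarith) hGb
    refine ⟨x, hx ▸ hGb x, ?_⟩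
    simpa [hx] using hGF x
  choose x hxR hx using happ
  obtain ⟨y, -, φ, hφ, hy⟩ := (isCompact_closedBall (0 : X) (R + 1)).tendsto_subseq
    (x := x) (fun n => by simpa using hxR n)
  refine ⟨y, (dist_eq_zero.1 ?_).symm⟩
  have h1 : Tendsto (fun n => dist (x (φ n)) (F (x (φ n)))) atTop (𝓝 (dist y (F y))) :=
    hy.dist ((hF.tendsto y).comp hy)
  refine tendsto_nhds_unique h1 (squeeze_zero (fun _ => dist_nonneg) (fun n => (hx (φ n)).le) ?_)
  exact tendsto_one_div_add_atTop_nhds_zero_nat.comp hφ.tendsto_atTop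

end

/-- Schauder's theorem, for continuous maps of a normed space into a compact subset of it. -/
theorem exists_fixedPoint_of_continuous_of_mapsTo_isCompact {E : Type*} [NormedAddCommGroup E]
    [NormedSpace ℝ E] {F : E → E} (hF : Continuous F) {S : Set E} (hS : IsCompact S)
    (hFS : ∀ x, F x ∈ S) : ∃ x, F x = x := by
  have happ : ∀ n : ℕ, ∃ x, dist x (F x) ≤ 1 / ((n : ℝ) + 1) := fun n => by
    have hn : (0 : ℝ) < 1 / ((n : ℝ) + 1) := by positivity
    set δ : ℝ := 1 / ((n : ℝ) + 1)
    obtain ⟨t, -, htf, ht⟩ := hS.finite_cover_balls hn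
    lift t to Finset E using htf
    -- Schauder projection: normalizing these weights gives a partition of unity on `S` subordinate
    -- to the `δ`-net `t`. Brouwer's theorem is applied to the coefficient vectors.
    let w : t → E → ℝ := fun i y => max 0 (δ - dist y i)
    have hw0 : ∀ i y, 0 ≤ w i y := fun i y => le_max_left _ _
    have hwc : ∀ i, Continuous (w i) := fun i => by fun_prop
    have hwpos : ∀ x, 0 < ∑ i, w i (F x) := fun x => by
      have := ht (hFS x)
      simp only [mem_iUnion, mem_ball] at this
      obtain ⟨i, hi, hxi⟩ := this
      refine Finset.sum_pos' (fun i _ => hw0 i _) ⟨⟨i, hi⟩, Finset.mem_univ _, ?_⟩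
      exact lt_max_of_lt_right (sub_pos.2 hxi)
    let p : t → E → ℝ := fun i x => w i (F x) / ∑ j, w j (F x)
    have hpc : ∀ i, Continuous (p i) := fun i =>
      ((hwc i).comp hF).div (continuous_finsetSum _ fun j _ => (hwc j).comp hF)
        fun x => (hwpos x).ne'
    have hp0 : ∀ i x, 0 ≤ p i x := fun i x => div_nonneg (hw0 _ _) (hwpos x).le
    have hpsum : ∀ x, ∑ i, p i x = 1 := fun x => by
      simp only [p]
      rw [← Finset.sum_div, div_self (hwpos x).ne']
    let L : EuclideanSpace ℝ t → E := fun l => ∑ i, l i • (i : E)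
    have hL : Continuous L := by fun_prop
    let Ψ : EuclideanSpace ℝ t → EuclideanSpace ℝ t := fun l => WithLp.toLp 2 fun i => p i (L l)
    have hΨ : Continuous Ψ :=
      (PiLp.continuous_toLp 2 _).comp (continuous_pi fun i => (hpc i).comp hL)
    have hΨb : ∀ l, ‖Ψ l‖ ≤ 1 := fun l => by
      rw [EuclideanSpace.norm_eq]
      refine Real.sqrt_le_iff.2 ⟨zero_le_one, ?_⟩
      rw [one_pow, ← hpsum (L l)]
      refine Finset.sum_le_sum fun i _ => ?_
      have h1 : p i (L l) ≤ 1 := hpsum (L l) ▸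
        Finset.single_le_sum (fun j _ => hp0 j (L l)) (Finset.mem_univ i)
      rw [Real.norm_of_nonneg (hp0 _ _), sq]
      exact mul_le_of_le_one_left (hp0 _ _) h1
    obtain ⟨l, hl⟩ := exists_fixedPoint_of_continuous_of_bounded hΨ hΨb
    have hli : ∀ i, l i = p i (L l) := fun i => by
      conv_lhs => rw [← hl]
    refine ⟨L l, ?_⟩
    have h1 : L l - F (L l) = ∑ i, p i (L l) • ((i : E) - F (L l)) := by
      simp only [smul_sub, Finset.sum_sub_distrib, ← Finset.sum_smul, hpsum, one_smul]
      congr 1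
      exact Finset.sum_congr rfl fun i _ => by rw [hli i]
    rw [dist_eq_norm, h1]
    calc ‖∑ i, p i (L l) • ((i : E) - F (L l))‖ ≤ ∑ i, p i (L l) * δ := by
          refine norm_sum_le_of_le _ fun i _ => ?_
          rw [norm_smul, Real.norm_of_nonneg (hp0 _ _)]
          rcases le_or_gt δ (dist (F (L l)) i) with h | h
          · have : p i (L l) = 0 := by simp [p, w, h]
            simp [this]
          · rw [← dist_eq_norm, dist_comm]
            exact mul_le_mul_of_nonneg_left h.le (hp0 _ _)
      _ = δ := by rw [← Finset.sum_mul, hpsum, one_mul]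
  choose x hx using happ
  obtain ⟨y, -, φ, hφ, hy⟩ := hS.tendsto_subseq fun n => hFS (x n)
  have hd : Tendsto (fun n => dist (x (φ n)) (F (x (φ n)))) atTop (𝓝 0) :=
    squeeze_zero (fun _ => dist_nonneg) (fun n => hx (φ n))
      (tendsto_one_div_add_atTop_nhds_zero_nat.comp hφ.tendsto_atTop)
  have hxy : Tendsto (fun n => x (φ n)) atTop (𝓝 y) :=
    tendsto_of_tendsto_of_dist hy (by simpa [dist_comm] using hd)
  exact ⟨y, tendsto_nhds_unique ((hF.tendsto y).comp hxy) hy⟩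

end Brouwer

/-! ### The boundary value problem as a fixed point equation. -/

section BoundaryValueProblem

open MeasureTheory Metric Filter
open scoped unitInterval

theorem isCompact_setOf_norm_le_lipschitzWith {E : Type*} [NormedAddCommGroup E]
    [NormedSpace ℝ E] [FiniteDimensional ℝ E] (r : ℝ) (K : NNReal) :
    ∃ S : Set C(I, E), IsCompact S ∧ ∀ f : C(I, E), ‖f‖ ≤ r → LipschitzWith K f → f ∈ S := by
  let A : Set (BoundedContinuousFunction I E) :=
    {f | (∀ x, f x ∈ closedBall 0 r) ∧ LipschitzWith K f}
  have hA : IsCompact (closure A) :=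
    BoundedContinuousFunction.arzela_ascoli (closedBall (0 : E) r) (isCompact_closedBall _ _) A
      (fun f x hf => hf.1 x)
      (LipschitzWith.uniformEquicontinuous _ K fun f => f.2.2).equicontinuous
  refine ⟨(ContinuousMap.isometryEquivBoundedOfCompact I E).toHomeomorph ⁻¹' closure A,
    (Homeomorph.isCompact_preimage _).2 hA, fun f hf hK => subset_closure ⟨fun x => ?_, hK⟩⟩
  exact mem_closedBall_zero_iff.2 ((f.norm_coe_le_norm x).trans hf)

/-- Extends an operator given on a ball to the whole space, so that Schauder's theorem can be used
in its global form. -/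
theorem exists_radialRetraction {E : Type*} [NormedAddCommGroup E] [NormedSpace ℝ E] {r : ℝ}
    (hr : 0 < r) : ∃ ρ : E → E, Continuous ρ ∧ (∀ v, ‖ρ v‖ ≤ r) ∧ ∀ v, ‖v‖ ≤ r → ρ v = v := by
  have hpos : ∀ v : E, 0 < max r ‖v‖ := fun v => lt_max_of_lt_left hr
  refine ⟨fun v => (r / max r ‖v‖) • v, ?_, fun v => ?_, fun v hv => ?_⟩
  · exact (continuous_const.div (by fun_prop) fun v => (hpos v).ne').smul continuous_id
  · rw [norm_smul, Real.norm_of_nonneg (div_nonneg hr.le (hpos v).le), div_mul_eq_mul_div,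
      div_le_iff₀ (hpos v)]
    exact mul_le_mul_of_nonneg_left (le_max_right _ _) hr.le
  · simp only [max_eq_left hv, div_self hr.ne', one_smul]

/-- If the mean of `v + c` is `d`, the mean of `‖v + c‖²` is at most `sup ‖v‖² + ‖d‖²`. -/
theorem integral_norm_add_sq_le {E : Type*} [NormedAddCommGroup E] [InnerProductSpace ℝ E]
    [CompleteSpace E] {v : ℝ → E} (hv : Continuous v) {c d : E} {r : ℝ} (hr : ∀ t, ‖v t‖ ≤ r)
    (hd : ∫ t in (0 : ℝ)..1, (v t + c) = d) :
    ∫ t in (0 : ℝ)..1, ‖v t + c‖ ^ 2 ≤ r ^ 2 + ‖d‖ ^ 2 := by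
  have h1 : ∀ t, ‖v t + c‖ ^ 2 ≤ (r ^ 2 - ‖c‖ ^ 2) + 2 * inner ℝ c (v t + c) := fun t => by
    have h2 : ‖v t + c‖ ^ 2 = ‖v t‖ ^ 2 - ‖c‖ ^ 2 + 2 * inner ℝ c (v t + c) := by
      rw [@norm_add_sq_real, inner_add_right, real_inner_self_eq_norm_sq,
        real_inner_comm]
      ring
    have h3 : ‖v t‖ ^ 2 ≤ r ^ 2 := pow_le_pow_left₀ (norm_nonneg _) (hr t) 2
    linarith
  have hvc : Continuous fun t => v t + c := hv.add continuous_const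
  have hin : Continuous fun t => inner ℝ c (v t + c) := continuous_const.inner hvc
  calc ∫ t in (0 : ℝ)..1, ‖v t + c‖ ^ 2
      ≤ ∫ t in (0 : ℝ)..1, ((r ^ 2 - ‖c‖ ^ 2) + 2 * inner ℝ c (v t + c)) :=
        intervalIntegral.integral_mono_on zero_le_one ((hvc.norm.pow 2).intervalIntegrable _ _)
          ((continuous_const.add (hin.const_mul 2)).intervalIntegrable _ _) fun t _ => h1 t
    _ = (r ^ 2 - ‖c‖ ^ 2) + 2 * inner ℝ c d := by
        rw [intervalIntegral.integral_add (by simp) ((hin.const_mul 2).intervalIntegrable _ _),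
          intervalIntegral.integral_const_mul, ← hd]
        have := (innerSL ℝ c).intervalIntegral_comp_comm (hvc.intervalIntegrable (μ := volume) 0 1)
        simp only [innerSL_apply_apply] at this
        rw [this]
        simp
    _ ≤ r ^ 2 + ‖d‖ ^ 2 := by
        have h4 := sq_nonneg ‖c - d‖
        have h5 := @norm_sub_sq_real E _ _ c d
        linarith

theorem continuous_integralCurve {X : Type*} [TopologicalSpace X] {v : X → C(I, E4)}
    {c : X → E4} {s : X → ℝ} (p : E4) (hv : Continuous v) (hc : Continuous c)
    (hs : Continuous s) :
    Continuous fun x => integralCurve p (v x) (c x) (s x) := by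
  unfold integralCurve
  refine continuous_const.add
    (intervalIntegral.continuous_parametric_intervalIntegral_of_continuous ?_ hs)
  refine Continuous.add ?_ (hc.comp continuous_fst)
  exact (hv.comp continuous_fst).eval (continuous_projIcc.comp continuous_snd)

/-- Schauder's theorem for integral operators on `C([0, 1], E)`. -/
theorem exists_eq_integral {E : Type*} [NormedAddCommGroup E] [NormedSpace ℝ E]
    [FiniteDimensional ℝ E] {G : C(I, E) → ℝ → E}
    (hG : Continuous fun p : C(I, E) × ℝ => G p.1 p.2) {r K : ℝ} (hr0 : 0 ≤ r) (hK : 0 ≤ K)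
    (hGK : ∀ v t, ‖G v t‖ ≤ K) (hGr : ∀ v, ∀ s ∈ Icc (0 : ℝ) 1, ‖∫ t in (0 : ℝ)..s, G v t‖ ≤ r) :
    ∃ v : C(I, E), ‖v‖ ≤ r ∧ ∀ s : I, v s = ∫ t in (0 : ℝ)..s, G v t := by
  have hGv : ∀ v, Continuous (G v) := fun v =>
    Continuous.comp (g := fun p : C(I, E) × ℝ => G p.1 p.2) hG (Continuous.prodMk_right v)
  have hc : Continuous fun p : C(I, E) × I => ∫ t in (0 : ℝ)..p.2, G p.1 t :=
    intervalIntegral.continuous_parametric_intervalIntegral_of_continuous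
      (f := fun (p : C(I, E) × I) t => G p.1 t)
      (Continuous.comp (g := fun p : C(I, E) × ℝ => G p.1 p.2)
        (f := fun q : (C(I, E) × I) × ℝ => (q.1.1, q.2)) hG (by fun_prop))
      (continuous_subtype_val.comp continuous_snd)
  let Φ : C(C(I, E), C(I, E)) := ContinuousMap.curry ⟨_, hc⟩
  have hΦs : ∀ v (s : I), Φ v s = ∫ t in (0 : ℝ)..s, G v t := fun v s => rfl
  have hΦr : ∀ v, ‖Φ v‖ ≤ r := fun v =>
    (ContinuousMap.norm_le _ hr0).2 fun s => hGr v s s.2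
  obtain ⟨S, hS, hSΦ⟩ := isCompact_setOf_norm_le_lipschitzWith (E := E) r ⟨K, hK⟩
  -- Integrals of functions bounded by `K` are `K`-Lipschitz in the upper limit, which puts them in
  -- the Arzelà–Ascoli compact set.
  obtain ⟨v, hv⟩ := exists_fixedPoint_of_continuous_of_mapsTo_isCompact Φ.continuous hS fun v => by
    refine hSΦ _ (hΦr v) (LipschitzWith.of_dist_le_mul fun s s' => ?_)
    rw [hΦs, hΦs, dist_eq_norm, intervalIntegral.integral_interval_sub_left
      ((hGv v).intervalIntegrable _ _) ((hGv v).intervalIntegrable _ _)]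
    exact intervalIntegral.norm_integral_le_of_norm_le_const fun t _ => hGK v t
  refine ⟨v, hv ▸ hΦr v, fun s => ?_⟩
  conv_lhs => rw [← hv, hΦs]

/-- Solution of the boundary value problem `x'' = Q (x, x')`, `x 0 = m₀`, `x 1 = m₁`, written for
`v = x' - c v`, by Schauder's fixed point theorem. -/
theorem exists_integralCurve_boundaryValue {Q : E4 → E4 → E4} {V : Set E4} {m₀ m₁ : E4} {ε C : ℝ}
    {c : C(I, E4) → E4} (hε : 0 < ε) (hC : 0 < C) (hc : ContinuousOn c (ball 0 ε))
    (hend : ∀ v ∈ ball 0 ε, integralCurve m₀ v (c v) 1 = m₁)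
    (hbound : ∀ v ∈ ball 0 ε, ‖c v‖ < C)
    (hstay : ∀ v ∈ ball 0 ε, ∀ s ∈ Icc (0 : ℝ) 1, integralCurve m₀ v (c v) s ∈ V)
    (hQ : ContinuousOn (fun p : E4 × E4 => Q p.1 p.2) (V ×ˢ univ))
    (hQb : ∀ x ∈ V, ∀ u, ‖Q x u‖ ≤ ε / (ε + C) ^ 2 * ‖u‖ ^ 2) :
    ∃ v ∈ ball (0 : C(I, E4)) ε, ∀ s : I, v s = ∫ t in (0 : ℝ)..s,
      Q (integralCurve m₀ v (c v) (projIcc (0 : ℝ) 1 zero_le_one t))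
        (IccExtend zero_le_one v t + c v) := by
  set κ := ε / (ε + C) ^ 2 with hκ
  have hκ0 : 0 < κ := by positivity
  -- `r` improves on `κ * (ε + C) ^ 2 = ε` by the cross term `2 * κ * ε * C`; this gap keeps the
  -- closed `r`-ball inside the open `ε`-ball.
  set r := κ * (ε ^ 2 + C ^ 2) with hr
  have hr0 : 0 < r := by positivity
  have hrε : r < ε := by
    rw [hr, hκ, div_mul_eq_mul_div, div_lt_iff₀ (by positivity)]
    have := mul_pos hε hC
    exact mul_lt_mul_of_pos_left (by nlinarith) hε
  have hmean : ∀ v ∈ ball (0 : C(I, E4)) ε,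
      ∫ t in (0 : ℝ)..1, (IccExtend zero_le_one v t + c v) = m₁ - m₀ := fun v hv => by
    rw [← hend v hv, integralCurve, add_sub_cancel_left]
  -- For `v = 0` the curve is straight, so `c 0 = m₁ - m₀`.
  have hd : ‖m₁ - m₀‖ ≤ C := by
    have h0 : (0 : C(I, E4)) ∈ ball 0 ε := mem_ball_self hε
    have h1 : c 0 = m₁ - m₀ := by
      rw [← hmean 0 h0]
      have : ∀ t : ℝ, IccExtend zero_le_one (0 : C(I, E4)) t = 0 := fun t => rfl
      simp only [this, zero_add]
      simp
    exact h1 ▸ (hbound 0 h0).le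
  obtain ⟨ρ, hρc, hρr, hρ⟩ := exists_radialRetraction (E := C(I, E4)) hr0
  have hρε : ∀ v, ρ v ∈ ball (0 : C(I, E4)) ε := fun v =>
    mem_ball_zero_iff.2 ((hρr v).trans_lt hrε)
  have hcρ : Continuous fun v => c (ρ v) := hc.comp_continuous hρc hρε
  obtain ⟨u, hudef⟩ : ∃ u : C(I, E4) → ℝ → E4,
      ∀ v t, u v t = IccExtend zero_le_one (ρ v) t + c (ρ v) := ⟨_, fun _ _ => rfl⟩
  have hu : Continuous fun p : C(I, E4) × ℝ => u p.1 p.2 := by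
    simp only [hudef]
    exact ((hρc.comp continuous_fst).eval (continuous_projIcc.comp continuous_snd)).add
      (hcρ.comp continuous_fst)
  obtain ⟨G, hGdef⟩ : ∃ G : C(I, E4) → ℝ → E4, ∀ v t, G v t =
      Q (integralCurve m₀ (ρ v) (c (ρ v)) (projIcc (0 : ℝ) 1 zero_le_one t)) (u v t) :=
    ⟨_, fun _ _ => rfl⟩
  have hV : ∀ v t, integralCurve m₀ (ρ v) (c (ρ v)) (projIcc (0 : ℝ) 1 zero_le_one t) ∈ V :=
    fun v t => hstay _ (hρε v) _ (projIcc (0 : ℝ) 1 zero_le_one t).2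
  have hG : Continuous fun p : C(I, E4) × ℝ => G p.1 p.2 := by
    simp only [hGdef]
    refine hQ.comp_continuous (f := fun p : C(I, E4) × ℝ =>
      (integralCurve m₀ (ρ p.1) (c (ρ p.1)) (projIcc (0 : ℝ) 1 zero_le_one p.2), u p.1 p.2))
      (Continuous.prodMk ?_ hu) fun p => ⟨hV _ _, mem_univ _⟩
    exact continuous_integralCurve m₀ (hρc.comp continuous_fst) (hcρ.comp continuous_fst)
      (continuous_subtype_val.comp (continuous_projIcc.comp continuous_snd))
  have hGv : ∀ v, Continuous (G v) := fun v => Continuous.comp (g := fun p : C(I, E4) × ℝ => G p.1 p.2) hG (Continuous.prodMk_right v)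
  have huv : ∀ v, Continuous (u v) := fun v => Continuous.comp (g := fun p : C(I, E4) × ℝ => u p.1 p.2) hu (Continuous.prodMk_right v)
  have hGu : ∀ v t, ‖G v t‖ ≤ κ * ‖u v t‖ ^ 2 := fun v t => by
    rw [hGdef]
    exact hQb _ (hV v t) _
  have hun : ∀ v t, ‖u v t‖ ≤ ε + C := fun v t => by
    rw [hudef]
    exact (norm_add_le _ _).trans (add_le_add
      ((((ρ v).norm_coe_le_norm _).trans (hρr v)).trans hrε.le) (hbound _ (hρε v)).le)
  have hGε : ∀ v t, ‖G v t‖ ≤ ε := fun v t => by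
    refine (hGu v t).trans ?_
    calc κ * ‖u v t‖ ^ 2 ≤ κ * (ε + C) ^ 2 := by gcongr; exact hun v t
      _ = ε := by rw [hκ]; field_simp
  have hGr : ∀ v, ∀ s ∈ Icc (0 : ℝ) 1, ‖∫ t in (0 : ℝ)..s, G v t‖ ≤ r := fun v s hs => by
    have hsq : Continuous fun t => κ * ‖u v t‖ ^ 2 := ((huv v).norm.pow 2).const_mul κ
    calc ‖∫ t in (0 : ℝ)..s, G v t‖ ≤ ∫ t in (0 : ℝ)..s, κ * ‖u v t‖ ^ 2 :=
          intervalIntegral.norm_integral_le_of_norm_le hs.1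
            (Eventually.of_forall fun t _ => hGu v t) (hsq.intervalIntegrable _ _)
      _ ≤ ∫ t in (0 : ℝ)..1, κ * ‖u v t‖ ^ 2 :=
          intervalIntegral.integral_mono_interval le_rfl hs.1 hs.2
            (Eventually.of_forall fun t => mul_nonneg hκ0.le (sq_nonneg _))
            (hsq.intervalIntegrable _ _)
      _ ≤ κ * (ε ^ 2 + ‖m₁ - m₀‖ ^ 2) := by
          rw [intervalIntegral.integral_const_mul]
          refine mul_le_mul_of_nonneg_left ?_ hκ0.le
          simp only [hudef]
          exact integral_norm_add_sq_le ((ρ v).continuous.comp continuous_projIcc)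
            (fun t => (((ρ v).norm_coe_le_norm _).trans (hρr v)).trans hrε.le) (hmean _ (hρε v))
      _ ≤ r := by
          rw [hr]
          gcongr
  obtain ⟨v, hvr, hv⟩ := exists_eq_integral hG hr0.le hε.le hGε hGr
  have hvρ : ρ v = v := hρ v hvr
  refine ⟨v, hvρ ▸ hρε v, fun s => ?_⟩
  rw [hv s]
  simp only [hGdef, hudef, hvρ]

end BoundaryValueProblem

/-! ### Linear algebra of the Lorentz scalar product. -/

section Minkowski

/-- `B` has an orthonormal frame of signature `(-, +, +, +)`. -/
def HasLorentzFrame (B : E4 →L[ℝ] E4 →L[ℝ] ℝ) : Prop :=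
  ∃ e : Fin 4 → E4, ∀ i j, B (e i) (e j) = minkowskiMatrix i j

variable {B : E4 →L[ℝ] E4 →L[ℝ] ℝ}

theorem HasLorentzFrame.exists_coord (hB : HasLorentzFrame B) :
    ∃ b : Module.Basis (Fin 4) ℝ E4, ∀ u w, B u w = -(b.repr u 0 * b.repr w 0) +
      (b.repr u 1 * b.repr w 1 + b.repr u 2 * b.repr w 2 + b.repr u 3 * b.repr w 3) := by
  obtain ⟨e, he⟩ := hB
  have hli : LinearIndependent ℝ e := by
    rw [Fintype.linearIndependent_iff]
    intro a ha j
    have h := congrArg (fun z => B z (e j)) ha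
    fin_cases j <;> simpa [Fin.sum_univ_four, he, minkowskiMatrix] using h
  let b := basisOfLinearIndependentOfCardEqFinrank hli (by simp)
  have hb : ∀ i, b i = e i := fun i => by simp [b]
  refine ⟨b, fun u w => ?_⟩
  conv_lhs => rw [← b.sum_repr u, ← b.sum_repr w]
  simp [Fin.sum_univ_four, hb, he, minkowskiMatrix]
  ring

theorem HasLorentzFrame.isInvertible (hB : HasLorentzFrame B) : B.IsInvertible := by
  obtain ⟨b, hb⟩ := hB.exists_coord
  have hinj : Function.Injective B := by
    rw [injective_iff_map_eq_zero]
    intro u hu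
    have h : ∀ j, B u (b j) = 0 := fun j => by rw [hu]; rfl
    refine (LinearEquiv.map_eq_zero_iff b.repr).1 (Finsupp.ext fun j => ?_)
    have hj := h j
    rw [hb] at hj
    fin_cases j <;> simpa using hj
  have hfr : Module.finrank ℝ E4 = Module.finrank ℝ (E4 →L[ℝ] ℝ) := by
    rw [← LinearEquiv.finrank_eq (LinearMap.toContinuousLinearMap (𝕜 := ℝ) (E := E4) (F' := ℝ))]
    exact (Subspace.dual_finrank_eq (K := ℝ) (V := E4)).symm
  refine ⟨(LinearMap.linearEquivOfInjective (B : E4 →ₗ[ℝ] E4 →L[ℝ] ℝ) hinj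
    hfr).toContinuousLinearEquiv, ?_⟩
  ext u w
  rfl

/-- Two timelike vectors are not orthogonal. -/
theorem HasLorentzFrame.ne_zero_of_timelike (hB : HasLorentzFrame B) {u w : E4} (hu : B u u < 0)
    (hw : B w w < 0) : B u w ≠ 0 := by
  obtain ⟨b, hb⟩ := hB.exists_coord
  rw [hb] at hu hw ⊢
  generalize b.repr u = a at *
  generalize b.repr w = c at *
  intro h
  have h1 : a 0 * c 0 = a 1 * c 1 + a 2 * c 2 + a 3 * c 3 := by linarith
  -- Cauchy–Schwarz on the spatial parts, by Lagrange's identity; it contradicts the dominance of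
  -- the time components in `h3`.
  have h2 : (a 1 * c 1 + a 2 * c 2 + a 3 * c 3) ^ 2 ≤
      (a 1 ^ 2 + a 2 ^ 2 + a 3 ^ 2) * (c 1 ^ 2 + c 2 ^ 2 + c 3 ^ 2) := by
    nlinarith [sq_nonneg (a 1 * c 2 - a 2 * c 1), sq_nonneg (a 1 * c 3 - a 3 * c 1),
      sq_nonneg (a 2 * c 3 - a 3 * c 2)]
  have h3 : (a 1 ^ 2 + a 2 ^ 2 + a 3 ^ 2) * (c 1 ^ 2 + c 2 ^ 2 + c 3 ^ 2) < a 0 ^ 2 * c 0 ^ 2 :=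
    mul_lt_mul'' (by linarith) (by linarith) (by positivity) (by positivity)
  rw [← h1, mul_pow] at h2
  linarith

end Minkowski

/-! ### Christoffel symbols: bound, continuity, conservation of the scalar square. -/

section Christoffel

variable {h : E4 → E4 →L[ℝ] E4 →L[ℝ] ℝ} {O : Set E4}

theorem christoffel_smul_smul (h : E4 → E4 →L[ℝ] E4 →L[ℝ] ℝ) (x u : E4) (a : ℝ) :
    christoffel h x (a • u) (a • u) = a ^ 2 • christoffel h x u u := by
  have : christoffelForm h x (a • u) (a • u) = a ^ 2 • christoffelForm h x u u := by
    ext w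
    simp [christoffelForm]
    ring
  rw [christoffel, christoffel, this, map_smul]

theorem norm_christoffel_le (h : E4 → E4 →L[ℝ] E4 →L[ℝ] ℝ) (x u : E4) :
    ‖christoffel h x u u‖ ≤ gravityNorm h x * ‖u‖ ^ 2 := by
  have h1 : ∀ w : E4, ‖w‖ ≤ 1 → ‖christoffel h x w w‖ ≤ gravityNorm h x := fun w hw => by
    rw [← norm_neg, ← gravity_eq]
    exact le_csSup (bddAbove_gravity h x) ⟨w, by simpa using hw, rfl⟩
  rcases eq_or_ne u 0 with rfl | hu
  · simpa using christoffel_smul_smul h x 0 0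
  · have hn : ‖u‖ ≠ 0 := norm_ne_zero_iff.2 hu
    have h2 : u = ‖u‖ • (‖u‖⁻¹ • u) := by rw [smul_smul, mul_inv_cancel₀ hn, one_smul]
    have h3 := h1 (‖u‖⁻¹ • u) (by rw [norm_smul, norm_inv, norm_norm, inv_mul_cancel₀ hn])
    conv_lhs => rw [h2, christoffel_smul_smul, norm_smul, norm_pow, norm_norm]
    rw [mul_comm]
    gcongr

theorem ContDiffOn.continuousOn_fderiv_flip_apply {E F : Type*} [NormedAddCommGroup E]
    [NormedSpace ℝ E] [NormedAddCommGroup F] [NormedSpace ℝ F] {S : Set E} {h : E → E →L[ℝ] F}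
    (hS : IsOpen S) (hh : ContDiffOn ℝ 1 h S) :
    ContinuousOn (fun p : E × E => fderiv ℝ h p.1 p.2) (S ×ˢ univ) ∧
      ContinuousOn (fun p : E × E => (fderiv ℝ h p.1).flip p.2) (S ×ˢ univ) := by
  have h1 : ContinuousOn (fun p : E × E => fderiv ℝ h p.1) (S ×ˢ univ) :=
    (hh.continuousOn_fderiv_of_isOpen hS le_rfl).comp continuousOn_fst fun p hp => hp.1
  exact ⟨h1.clm_apply continuousOn_snd,
    ((ContinuousLinearMap.flipₗᵢ ℝ E E F).continuous.comp_continuousOn h1).clm_apply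
      continuousOn_snd⟩

theorem ContinuousOn.christoffel_aux {E F : Type*} [NormedAddCommGroup E] [NormedSpace ℝ E]
    [NormedAddCommGroup F] [NormedSpace ℝ F] {S : Set E} {h : E → E →L[ℝ] E →L[ℝ] ℝ}
    {J : E → (E →L[ℝ] ℝ) →L[ℝ] F} (hS : IsOpen S) (hh : ContDiffOn ℝ 1 h S)
    (hJ : ContinuousOn J S) :
    ContinuousOn (fun p : E × E => J p.1 ((1 / 2 : ℝ) • (fderiv ℝ h p.1 p.2 p.2 +
      fderiv ℝ h p.1 p.2 p.2 - ((fderiv ℝ h p.1).flip p.2).flip p.2))) (S ×ˢ univ) := by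
  obtain ⟨h2, h5⟩ := hh.continuousOn_fderiv_flip_apply hS
  have h3 : ContinuousOn (fun p : E × E => fderiv ℝ h p.1 p.2 p.2) (S ×ˢ univ) :=
    h2.clm_apply continuousOn_snd
  have h4 : ContinuousOn (fun p : E × E => ((fderiv ℝ h p.1).flip p.2).flip p.2)
      (S ×ˢ univ) :=
    ((ContinuousLinearMap.flipₗᵢ ℝ E E ℝ).continuous.comp_continuousOn h5).clm_apply
      continuousOn_snd
  exact (hJ.comp continuousOn_fst fun p hp => hp.1).clm_apply
    (((h3.add h3).sub h4).const_smul (1 / 2 : ℝ))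

theorem continuousOn_christoffel (hO : IsOpen O) (hh : ContDiffOn ℝ 1 h O)
    (hinv : ∀ x ∈ O, (h x).IsInvertible) :
    ContinuousOn (fun p : E4 × E4 => christoffel h p.1 p.2 p.2) (O ×ˢ univ) := by
  -- `ContinuousLinearMap.inverse` is zero at non-invertible maps; continuity is available at the
  -- invertible ones.
  have hI : ContinuousOn (fun x => (h x).inverse) O := fun x hx => by
    obtain ⟨L, hL⟩ := hinv x hx
    have : ContinuousAt ContinuousLinearMap.inverse (h x) := by
      rw [← hL]
      exact (contDiffAt_map_inverse (n := 0) L).continuousAt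
    exact this.comp_continuousWithinAt (hh.continuousOn x hx)
  exact ContinuousOn.christoffel_aux hO hh hI

theorem HasDerivWithinAt.fieldOfLinear_apply {E F : Type*} [NormedAddCommGroup E]
    [NormedSpace ℝ E] [NormedAddCommGroup F] [NormedSpace ℝ F] {h : E → E →L[ℝ] F} {x u : ℝ → E}
    {u' x' : E} {s : Set ℝ} {t : ℝ} (hh : DifferentiableAt ℝ h (x t))
    (hx : HasDerivWithinAt x x' s t) (hu : HasDerivWithinAt u u' s t) :
    HasDerivWithinAt (fun t => h (x t) (u t)) (fderiv ℝ h (x t) x' (u t) + h (x t) u') s t :=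
  (hh.hasFDerivAt.comp_hasDerivWithinAt t hx).clm_apply hu

theorem HasDerivWithinAt.bilin_apply_self {E : Type*} [NormedAddCommGroup E] [NormedSpace ℝ E]
    {h : E → E →L[ℝ] E →L[ℝ] ℝ} {x u : ℝ → E} {u' x' : E} {s : Set ℝ} {t : ℝ}
    (hh : DifferentiableAt ℝ h (x t)) (hx : HasDerivWithinAt x x' s t)
    (hu : HasDerivWithinAt u u' s t) :
    HasDerivWithinAt (fun t => h (x t) (u t) (u t))
      (fderiv ℝ h (x t) x' (u t) (u t) + h (x t) u' (u t) + h (x t) (u t) u') s t :=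
  (HasDerivWithinAt.fieldOfLinear_apply hh hx hu).clm_apply hu

/-- The scalar square of the velocity of a geodesic is constant. -/
theorem metric_velocity_eq_of_geodesic (hO : IsOpen O) (hh : ContDiffOn ℝ 1 h O)
    (hinv : ∀ x ∈ O, (h x).IsInvertible) (hsymm : ∀ x ∈ O, ∀ u w, h x u w = h x w u)
    {x u : ℝ → E4} {a b : ℝ} (hxO : ∀ t ∈ Icc a b, x t ∈ O)
    (hx : ∀ t ∈ Icc a b, HasDerivWithinAt x (u t) (Icc a b) t)
    (hu : ∀ t ∈ Icc a b, HasDerivWithinAt u (-christoffel h (x t) (u t) (u t)) (Icc a b) t) :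
    ∀ t ∈ Icc a b, h (x t) (u t) (u t) = h (x a) (u a) (u a) := by
  have key : ∀ t ∈ Icc a b, HasDerivWithinAt (fun t => h (x t) (u t) (u t)) 0 (Icc a b) t := by
    intro t ht
    have h1 := HasDerivWithinAt.bilin_apply_self
      ((hh.contDiffAt (hO.mem_nhds (hxO t ht))).differentiableAt one_ne_zero) (hx t ht) (hu t ht)
    refine h1.congr_deriv ?_
    -- With three equal arguments `h(Γ(u, u), u) = ½ ∂_u h(u, u)`, which cancels the derivative of
    -- the metric.
    have h2 := christoffel_spec h (x t) (u t) (u t) (u t) (hinv _ (hxO t ht))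
    have h3 := hsymm _ (hxO t ht) (u t) (christoffel h (x t) (u t) (u t))
    rw [map_neg, map_neg, neg_apply, h3, h2]
    ring
  refine constant_of_derivWithin_zero (fun t ht => (key t ht).differentiableWithinAt)
    fun t ht => ?_
  have ht' : t ∈ Icc a b := Ico_subset_Icc_self ht
  exact (key t ht').derivWithin (uniqueDiffOn_Icc (ht.1.trans_lt ht.2) t ht')

end Christoffel

/-! ### Passing between the manifold and a chart. -/

section Chart

variable {M : Type*} [TopologicalSpace M] [ChartedSpace E4 M]

theorem OpenPartialHomeomorph.mdifferentiable_of_mem_maximalAtlas {e : OpenPartialHomeomorph M E4}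
    (he : e ∈ IsManifold.maximalAtlas 𝓘(ℝ, E4) ∞ M) :
    e.MDifferentiable 𝓘(ℝ, E4) 𝓘(ℝ, E4) :=
  ⟨(contMDiffOn_of_mem_maximalAtlas he).mdifferentiableOn (by simp),
    (contMDiffOn_symm_of_mem_maximalAtlas he).mdifferentiableOn (by simp)⟩

theorem velocity_symm_comp {e : OpenPartialHomeomorph M E4}
    (he : e.MDifferentiable 𝓘(ℝ, E4) 𝓘(ℝ, E4)) {x : ℝ → E4} {u : E4} {s : Set ℝ} {t : ℝ}
    (hs : UniqueDiffWithinAt ℝ s t) (hx : HasDerivWithinAt x u s t) (hxt : x t ∈ e.target) :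
    velocity (fun t => e.symm (x t)) s t = mfderiv 𝓘(ℝ, E4) 𝓘(ℝ, E4) e.symm (x t) u := by
  have h1 : HasMFDerivWithinAt 𝓘(ℝ, ℝ) 𝓘(ℝ, E4) x s t
      (ContinuousLinearMap.toSpanSingleton ℝ u) := hx.hasFDerivWithinAt.hasMFDerivWithinAt
  have h2 := (he.mdifferentiableAt_symm hxt).hasMFDerivAt.comp_hasMFDerivWithinAt t h1
  have h3 := h2.mfderivWithin (uniqueMDiffWithinAt_iff_uniqueDiffWithinAt.2 hs)
  have h4 := DFunLike.congr_fun h3 (1 : ℝ)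
  refine h4.trans ?_
  refine congrArg (mfderiv 𝓘(ℝ, E4) 𝓘(ℝ, E4) e.symm (x t)) ?_
  exact one_smul ℝ u

namespace LorentzMetric

variable (g : LorentzMetric M) {e : OpenPartialHomeomorph M E4}

theorem inChart_symm (x u w : E4) : g.inChart e x u w = g.inChart e x w u := g.symm _ _ _

theorem hasLorentzFrame_inChart (he : e.MDifferentiable 𝓘(ℝ, E4) 𝓘(ℝ, E4)) {x : E4}
    (hx : x ∈ e.target) : HasLorentzFrame (g.inChart e x) := by
  obtain ⟨f, hf⟩ := g.signature (e.symm x)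
  have hsurj := he.symm.mfderiv_surjective (x := x) hx
  choose f' hf' using fun i => hsurj (f i)
  refine ⟨f', fun i j => ?_⟩
  refine Eq.trans (b := g.form (e.symm x) (f i) (f j)) ?_ (hf i j)
  exact congrArg₂ (fun a b => g.form (e.symm x) a b) (hf' i) (hf' j)

theorem isGeodesicOn_symm_comp (he : e ∈ IsManifold.maximalAtlas 𝓘(ℝ, E4) ∞ M)
    {x u : ℝ → E4} {s : Set ℝ} (hxe : ∀ t ∈ s, x t ∈ e.target)
    (hx : ∀ t ∈ s, HasDerivWithinAt x (u t) s t)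
    (hu : ∀ t ∈ s, HasDerivWithinAt u (-christoffel (g.inChart e) (x t) (u t) (u t)) s t) :
    g.IsGeodesicOn (fun t => e.symm (x t)) s := by
  refine ⟨e.continuousOn_symm.comp (fun t ht => (hx t ht).continuousWithinAt) hxe,
    fun t ht => ⟨e, he, e.map_target (hxe t ht), u, ?_⟩⟩
  filter_upwards [self_mem_nhdsWithin] with t' ht'
  rw [e.right_inv (hxe t' ht')]
  exact ⟨(hx t' ht').congr (fun r hr => e.right_inv (hxe r hr)) (e.right_inv (hxe t' ht')),
    hu t' ht'⟩

variable {g} [IsManifold 𝓘(ℝ, E4) ∞ M]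

/-- Coordinates of a time orientation: a continuous vector field on the target of the chart. -/
theorem TimeOrientation.exists_coord (τ : g.TimeOrientation)
    (he : e ∈ IsManifold.maximalAtlas 𝓘(ℝ, E4) ∞ M) :
    ∃ Y : E4 → E4, ContinuousOn Y e.target ∧
      ∀ x ∈ e.target, mfderiv 𝓘(ℝ, E4) 𝓘(ℝ, E4) e.symm x (Y x) = τ.field (e.symm x) := by
  have hed := OpenPartialHomeomorph.mdifferentiable_of_mem_maximalAtlas he
  refine ⟨fun x => mfderivWithin 𝓘(ℝ, E4) 𝓘(ℝ, E4) e e.source (e.symm x) (τ.field (e.symm x)),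
    ?_, fun x hx => ?_⟩
  · have h1 := (contMDiffOn_of_mem_maximalAtlas he).continuousOn_tangentMapWithin
      (by simp) e.open_source.uniqueMDiffOn
    have h2 : ContinuousOn (fun x => (⟨e.symm x, τ.field (e.symm x)⟩ : TangentBundle 𝓘(ℝ, E4) M))
        e.target := τ.continuous.comp_continuousOn e.continuousOn_symm
    have h3 := h1.comp h2 fun x hx => e.map_target hx
    have h4 := (tangentBundleModelSpaceHomeomorph 𝓘(ℝ, E4)).continuous.comp_continuousOn h3
    exact continuous_snd.comp_continuousOn h4
  · have hs : e.symm x ∈ e.source := e.map_target hx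
    have h1 := hed.symm_comp_deriv hs
    rw [e.right_inv hx] at h1
    have h2 := DFunLike.congr_fun
      (mfderivWithin_of_isOpen (I := 𝓘(ℝ, E4)) (I' := 𝓘(ℝ, E4)) (f := e) e.open_source hs)
      (τ.field (e.symm x))
    exact (congrArg (mfderiv 𝓘(ℝ, E4) 𝓘(ℝ, E4) e.symm x) h2).trans
      (DFunLike.congr_fun h1 (τ.field (e.symm x)))

end LorentzMetric

end Chart

/-- Serves to propagate the sign of a product with the time orientation, first among the vectors `c
v`, then along the geodesic. -/
theorem ContinuousOn.neg_of_ne_zero {f : ℝ → ℝ} (hf : ContinuousOn f (Icc 0 1))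
    (h : ∀ t ∈ Icc (0 : ℝ) 1, f t ≠ 0) (h0 : f 0 < 0) : ∀ t ∈ Icc (0 : ℝ) 1, f t < 0 := by
  intro t ht
  by_contra! hpos
  obtain ⟨s, hs, hfs⟩ := isPreconnected_Icc.intermediate_value
    (left_mem_Icc.2 zero_le_one) ht hf ⟨h0.le, hpos⟩
  exact h s hs hfs

/-! ### The geodesic and its initial direction in coordinates. -/

section Coordinates

open MeasureTheory

variable {h : E4 → E4 →L[ℝ] E4 →L[ℝ] ℝ} {m₀ m₁ : E4} {ε C : ℝ} {c : C(unitInterval, E4) → E4}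

theorem hasDerivAt_integralCurve (p : E4) (v : C(unitInterval, E4)) (w : E4) (s : ℝ) :
    HasDerivAt (integralCurve p v w) (IccExtend zero_le_one v s + w) s :=
  (Continuous.integral_hasStrictDerivAt (v.continuous.Icc_extend'.add continuous_const)
    0 s).hasDerivAt.const_add p

theorem contDiff_integralCurve (p : E4) (v : C(unitInterval, E4)) (w : E4) :
    ContDiff ℝ 1 (integralCurve p v w) := by
  rw [contDiff_one_iff_deriv]
  refine ⟨fun s => (hasDerivAt_integralCurve p v w s).differentiableAt, ?_⟩
  rw [funext fun s => (hasDerivAt_integralCurve p v w s).deriv]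
  exact v.continuous.Icc_extend'.add continuous_const

theorem IsCorrection.apply_zero (hc : IsCorrection h m₀ m₁ ε C c) : c 0 = m₁ - m₀ := by
  have h1 := hc.endpoint 0 (Metric.mem_ball_self hc.eps_pos)
  have h2 : ∀ t : ℝ, IccExtend zero_le_one (0 : C(unitInterval, E4)) t = 0 := fun t => rfl
  simp only [integralCurve, h2, zero_add] at h1
  rw [← h1]
  simp

/-- The vectors `c v` are in the same half of the light cone as `m₁ - m₀`. -/
theorem IsCorrection.apply_neg (hc : IsCorrection h m₀ m₁ ε C c) (hL : HasLorentzFrame (h m₀))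
    {Y : E4} (hY : h m₀ Y Y < 0) (h0 : h m₀ (m₁ - m₀) Y < 0) {v : C(unitInterval, E4)}
    (hv : v ∈ Metric.ball 0 ε) : h m₀ (c v) Y < 0 := by
  have hmem : ∀ t ∈ Icc (0 : ℝ) 1, t • v ∈ Metric.ball (0 : C(unitInterval, E4)) ε := by
    intro t ht
    rw [mem_ball_zero_iff] at hv ⊢
    rw [norm_smul, Real.norm_of_nonneg ht.1]
    exact (mul_le_of_le_one_left (norm_nonneg _) ht.2).trans_lt hv
  have hcont : ContinuousOn (fun t : ℝ => h m₀ (c (t • v)) Y) (Icc 0 1) := by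
    have h1 : ContinuousOn (fun t : ℝ => c (t • v)) (Icc 0 1) :=
      hc.continuousOn.comp (by fun_prop) hmem
    exact ((h m₀).continuous.comp_continuousOn h1).clm_apply continuousOn_const
  have hz : (0 : ℝ) • v = 0 := zero_smul ℝ v
  have hone : (1 : ℝ) • v = v := one_smul ℝ v
  have := hcont.neg_of_ne_zero
    (fun t ht => hL.ne_zero_of_timelike (hc.timelike _ (hmem t ht)) hY)
    (by rwa [hz, hc.apply_zero]) 1 (right_mem_Icc.2 zero_le_one)
  rwa [hone] at this

theorem IsCorrection.exists_geodesic (hc : IsCorrection h m₀ m₁ ε C c) {O V : Set E4}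
    (hO : IsOpen O) (hh : ContDiffOn ℝ 1 h O) (hL : ∀ x ∈ O, HasLorentzFrame (h x)) (hVO : V ⊆ O)
    (hstay : ∀ v ∈ Metric.ball 0 ε, ∀ s ∈ Icc (0 : ℝ) 1, integralCurve m₀ v (c v) s ∈ V)
    (hG : ∀ x ∈ V, gravityNorm h x ≤ ε / (ε + C) ^ 2) :
    ∃ x u : ℝ → E4, ContDiff ℝ 1 x ∧ (∀ t, HasDerivAt x (u t) t) ∧
      (∀ t ∈ Icc (0 : ℝ) 1, x t ∈ O) ∧
      (∀ t ∈ Icc (0 : ℝ) 1,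
        HasDerivWithinAt u (-christoffel h (x t) (u t) (u t)) (Icc 0 1) t) ∧
      x 0 = m₀ ∧ x 1 = m₁ ∧ ∃ v ∈ Metric.ball 0 ε, u 0 = c v := by
  have hQ := (continuousOn_christoffel hO hh fun x hx => (hL x hx).isInvertible).neg.mono
    (prod_mono_left (t := univ) hVO)
  obtain ⟨v, hv, hvs⟩ := exists_integralCurve_boundaryValue
    (Q := fun x u => -christoffel h x u u) (V := V) (m₁ := m₁) hc.eps_pos hc.C_pos hc.continuousOn
    hc.endpoint hc.bound hstay hQ (fun x hx u => by
      rw [norm_neg]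
      exact (norm_christoffel_le h x u).trans (by gcongr; exact hG x hx))
  set x : ℝ → E4 := integralCurve m₀ v (c v) with hxdef
  set u : ℝ → E4 := fun t => IccExtend zero_le_one v t + c v with hudef
  have hx : ∀ t, HasDerivAt x (u t) t := hasDerivAt_integralCurve m₀ v (c v)
  have hu : Continuous u := v.continuous.Icc_extend'.add continuous_const
  -- Projecting time to `[0, 1]` makes the integrand continuous on all of `ℝ`, so the fundamental
  -- theorem of calculus also holds at the end points.
  let q : ℝ → E4 := fun t =>
    -christoffel h (x (projIcc (0 : ℝ) 1 zero_le_one t)) (u t) (u t)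
  have hq : Continuous q := by
    refine hQ.comp_continuous (f := fun t => (x (projIcc (0 : ℝ) 1 zero_le_one t), u t))
      (Continuous.prodMk ?_ hu) fun t => ⟨hstay v hv _ (projIcc (0 : ℝ) 1 zero_le_one t).2,
        mem_univ _⟩
    exact (contDiff_integralCurve m₀ v (c v)).continuous.comp
      (continuous_subtype_val.comp continuous_projIcc)
  have hus : ∀ s ∈ Icc (0 : ℝ) 1, u s = (∫ t in (0 : ℝ)..s, q t) + c v := fun s hs => by
    rw [hudef]
    simp only [IccExtend_of_mem zero_le_one v hs]
    rw [hvs]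
  refine ⟨x, u, contDiff_integralCurve m₀ v (c v), hx,
    fun t ht => hVO (hstay v hv t ht), fun t ht => ?_, ?_, hc.endpoint v hv, v, hv, ?_⟩
  · have h1 := ((hq.integral_hasStrictDerivAt 0 t).hasDerivAt.add_const
      (c v)).hasDerivWithinAt (s := Icc 0 1)
    refine (h1.congr hus (hus t ht)).congr_deriv ?_
    simp only [q]
    rw [projIcc_of_mem zero_le_one ht]
  · simp [hxdef, integralCurve]
  · rw [hus 0 (left_mem_Icc.2 zero_le_one)]
    simp

end Coordinates

/-! ### The main theorem on the manifold. -/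

theorem mainTheorem1 {M : Type*} [TopologicalSpace M] [T2Space M] [ChartedSpace E4 M]
    [IsManifold 𝓘(ℝ, E4) ∞ M]
    (g : LorentzMetric M) (m : M) (R : g.ReferenceFrame m)
    -- the straight segment in `O` from `m₀` to `m₁`, with direction inside the light cone at `m₀`
    (m₀ m₁ : E4) (T : ℝ) (hT : 0 < T) (a : ℝ →ᵃ[ℝ] E4) (ha₀ : a 0 = m₀) (ha₁ : a T = m₁)
    (haO : ∀ t ∈ Icc 0 T, a t ∈ R.domain)
    (hcone : R.metric m₀ (deriv a 0) (deriv a 0) < 0)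
    (ε C : ℝ) (c : C(unitInterval, E4) → E4) (hc : IsCorrection R.metric m₀ m₁ ε C c)
    -- the ball `V`
    (V : Set E4) (hV : ∃ z r, V = Metric.ball z r ∨ V = Metric.closedBall z r)
    (hVO : V ⊆ R.domain) (hm₀ : m₀ ∈ V) (hm₁ : m₁ ∈ V)
    (hstay : ∀ v ∈ Metric.ball 0 ε, ∀ s ∈ Icc (0 : ℝ) 1, integralCurve m₀ v (c v) s ∈ V)
    (hG : ∀ x ∈ V, gravityNorm R.metric x < ε / (ε + C) ^ 2) :
    ∃ γ : ℝ → M,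
      g.IsGeodesicOn γ (Icc 0 T) ∧
      (∀ t ∈ Icc 0 T, g.IsTimelike (velocity γ (Icc 0 T) t)) ∧
      γ 0 = R.event m₀ ∧ γ T = R.event m₁ ∧
      ∀ τ : g.TimeOrientation, τ.IsFuture (R.tangent m₀ (deriv a 0)) →
        (∀ t ∈ Icc 0 T, τ.IsFuture (velocity γ (Icc 0 T) t)) ∧
        R.event m₁ ∈ τ.properFuture (R.event m₀) := by
  have he := R.chart_mem
  have hed := OpenPartialHomeomorph.mdifferentiable_of_mem_maximalAtlas he
  have hh : ContDiffOn ℝ 1 R.metric R.domain := (g.smooth _ he).of_le (by simp)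
  have hO : IsOpen R.domain := R.chart.open_target
  have hL : ∀ x ∈ R.domain, HasLorentzFrame (R.metric x) := fun x hx =>
    g.hasLorentzFrame_inChart hed hx
  obtain ⟨x, u, hx1, hx, hxO, hu, hx0, hxm, v, hv, hu0⟩ :=
    hc.exists_geodesic hO hh hL hVO hstay fun x hx => (hG x hx).le
  have htl : ∀ t ∈ Icc (0 : ℝ) 1, R.metric (x t) (u t) (u t) < 0 := fun t ht => by
    rw [metric_velocity_eq_of_geodesic hO hh (fun x hx => (hL x hx).isInvertible)
      (fun x _ => g.inChart_symm x) hxO (fun t _ => (hx t).hasDerivWithinAt) hu t ht, hx0, hu0]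
    exact hc.timelike v hv
  -- Affine reparametrization from `[0, 1]` to `[0, T]`: the acceleration and the quadratic
  -- Christoffel term both scale by `T⁻²`.
  have hTmem : ∀ t ∈ Icc 0 T, T⁻¹ * t ∈ Icc (0 : ℝ) 1 := fun t ht =>
    ⟨mul_nonneg (inv_nonneg.2 hT.le) ht.1, by
      rw [inv_mul_le_iff₀ hT, mul_one]; exact ht.2⟩
  have hlin : ∀ t : ℝ, HasDerivAt (fun t => T⁻¹ * t) T⁻¹ t := fun t => by
    simpa using (hasDerivAt_id t).const_mul T⁻¹
  have hxT : ∀ t ∈ Icc 0 T,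
      HasDerivWithinAt (fun t => x (T⁻¹ * t)) (T⁻¹ • u (T⁻¹ * t)) (Icc 0 T) t := fun t _ =>
    ((hx _).scomp t (hlin t)).hasDerivWithinAt
  have huT : ∀ t ∈ Icc 0 T, HasDerivWithinAt (fun t => T⁻¹ • u (T⁻¹ * t))
      (-christoffel R.metric (x (T⁻¹ * t)) (T⁻¹ • u (T⁻¹ * t)) (T⁻¹ • u (T⁻¹ * t)))
      (Icc 0 T) t := fun t ht => by
    refine (((hu _ (hTmem t ht)).scomp t (hlin t).hasDerivWithinAt hTmem).const_smul
      T⁻¹).congr_deriv ?_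
    rw [christoffel_smul_smul, smul_neg, smul_neg, smul_smul, sq]
  have hvelT : ∀ t ∈ Icc 0 T,
      velocity (fun t => R.chart.symm (x (T⁻¹ * t))) (Icc 0 T) t =
        mfderiv 𝓘(ℝ, E4) 𝓘(ℝ, E4) R.chart.symm (x (T⁻¹ * t)) (T⁻¹ • u (T⁻¹ * t)) :=
    fun t ht => velocity_symm_comp hed (uniqueDiffOn_Icc hT t ht) (hxT t ht)
      (hxO _ (hTmem t ht))
  have htlT : ∀ t ∈ Icc 0 T, g.IsTimelike
      (velocity (fun t => R.chart.symm (x (T⁻¹ * t))) (Icc 0 T) t) := fun t ht => by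
    rw [hvelT t ht]
    have h1 : R.metric (x (T⁻¹ * t)) (T⁻¹ • u (T⁻¹ * t)) (T⁻¹ • u (T⁻¹ * t)) < 0 := by
      simp only [map_smul, smul_apply, smul_eq_mul]
      exact mul_neg_of_pos_of_neg (by positivity)
        (mul_neg_of_pos_of_neg (by positivity) (htl _ (hTmem t ht)))
    exact h1
  refine ⟨fun t => R.chart.symm (x (T⁻¹ * t)),
    g.isGeodesicOn_symm_comp he (fun t ht => hxO _ (hTmem t ht)) hxT huT, htlT, ?_, ?_,
    fun τ hτ => ?_⟩
  · simp [hx0, LorentzMetric.ReferenceFrame.event]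
  · simp [hxm, hT.ne', LorentzMetric.ReferenceFrame.event]
  obtain ⟨Y, hYc, hY⟩ := τ.exists_coord he
  have hform : ∀ z ∈ R.domain, ∀ w : E4, g.form (R.chart.symm z)
      (mfderiv 𝓘(ℝ, E4) 𝓘(ℝ, E4) R.chart.symm z w) (τ.field (R.chart.symm z)) =
        R.metric z w (Y z) := fun z hz w => by
    rw [← hY z hz]
    rfl
  have hYt : ∀ z ∈ R.domain, R.metric z (Y z) (Y z) < 0 := fun z hz => by
    rw [← hform z hz, hY z hz]
    exact τ.timelike _
  have hdir : m₁ - m₀ = T • deriv a 0 := by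
    have h1 : ∀ t, a t = t • a.linear 1 + m₀ := fun t => by
      rw [← map_smul, smul_eq_mul, mul_one, ← ha₀]
      simpa using a.map_vadd 0 t
    have h2 : HasDerivAt a (a.linear 1) 0 := by
      rw [funext h1]
      simpa using ((hasDerivAt_id (0 : ℝ)).smul_const (a.linear 1)).add_const m₀
    rw [h2.deriv, ← ha₁, h1 T, add_sub_cancel_right]
  have hm₀O := hVO hm₀
  have hstart : R.metric m₀ (c v) (Y m₀) < 0 := by
    refine hc.apply_neg (hL _ hm₀O) (hYt _ hm₀O) ?_ hv
    rw [hdir, map_smul, smul_apply, smul_eq_mul, ← hform _ hm₀O]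
    exact mul_neg_of_pos_of_neg hT hτ.2
  have hxc : ContinuousOn x (Icc 0 1) := hx1.continuous.continuousOn
  have huc : ContinuousOn u (Icc 0 1) := fun t ht => (hu t ht).continuousWithinAt
  have hfut : ∀ t ∈ Icc (0 : ℝ) 1, R.metric (x t) (u t) (Y (x t)) < 0 := by
    refine ContinuousOn.neg_of_ne_zero (f := fun t => R.metric (x t) (u t) (Y (x t))) ?_
      (fun t ht => (hL _ (hxO t ht)).ne_zero_of_timelike (htl t ht) (hYt _ (hxO t ht))) ?_
    · exact ((hh.continuousOn.comp hxc hxO).clm_apply huc).clm_apply (hYc.comp hxc hxO)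
    · simpa only [hx0, hu0] using hstart
  -- `properFuture` asks for a curve on `[0, 1]`, so its witness is the geodesic before
  -- reparametrization.
  refine ⟨fun t ht => ⟨htlT t ht, ?_⟩, fun t => R.chart.symm (x t), ?_, ?_, ?_, fun t ht => ?_⟩
  · rw [hvelT t ht, hform _ (hxO _ (hTmem t ht)), map_smul, smul_apply,
      smul_eq_mul]
    exact mul_neg_of_pos_of_neg (inv_pos.2 hT) (hfut _ (hTmem t ht))
  · exact ((contMDiffOn_symm_of_mem_maximalAtlas he).of_le (by simp)).comp
      hx1.contMDiff.contMDiffOn hxO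
  · simp [hx0, LorentzMetric.ReferenceFrame.event]
  · simp [hxm, LorentzMetric.ReferenceFrame.event]
  · have hvel := velocity_symm_comp hed (uniqueDiffOn_Icc zero_lt_one t ht)
      (hx t).hasDerivWithinAt (hxO t ht)
    rw [hvel]
    refine ⟨htl t ht, ?_⟩
    rw [hform _ (hxO t ht)]
    exact hfut t ht
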